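/- Let $T$ be a complete first-order theory in a language $L$, with $|T| = |L|+\aleph_0$, let $M \models T$, $A\subseteq M$, and let $p(x)$ be a partial type over $A$ in a finite tuple $x$ of variables. Realizations of $p$ and sequences are taken in elementary extensions of $M$ (equivalently, in a monster model containing $A$). A sequence $I=\langle b_t : t\in O\rangle$ of tuples, indexed by an infinite linear order $O$, is *indiscernible over* a set $B$ if for all $k<\omega$ and all $t_1<\dots<t_k$, $t'_1<\dots<t'_k$ in $O$ the tuples $(b_{t_1},\dots,b_{t_k})$ and $(b_{t'_1},\dots,b_{t'_k})$ have the same type over $B$. Sequences $\langle I_i : i\in S\rangle$ are *mutually indiscernible over* $B$ if each $I_i$ is indiscernible over $B\cup\bigcup_{j\neq i} I_j$. For a cardinal $\kappa$, $p$ has *dp-rank $<\kappa$* if for every realization $a$ of $p$ and any $\kappa$ sequences mutually indiscernible over $A$, at least one of them is indiscernible over $Aa$. The type $p$ is *independent* (has dp-rank $\infty$) if it has dp-rank $<\kappa$ for no cardinal $\kappa$. **Theorem.** If $p$ is independent, then there are (in some elementary extension of $M$) a set $A'\supseteq A$ with $A'\setminus A$ finite, a realization $a\models p$, and a family $\langle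 I_i : i<|T|^++|A|^+\rangle$ of sequences of singletons (that is, of single elements), each of order type $\omega$, which are mutually indiscernible over $A'$ and such that for every $i$, $I_i$ is not indiscernible over $A'a$. -/

import Mathlib

open Cardinal FirstOrder

universe u v w

namespace FirstOrder.Language

/-- The sequence `s`, indexed by a linear order `I`, of `α`-tuples of `N` is indiscernible over
`B ⊆ N`: any two increasing finite tuples of indices (of the same length) give tuples that satisfy
the same formulas with parameters in `B`. -/
def IndiscernibleOver (L : Language.{u, v}) {N : Type*} [L.Structure N] (B : Set N)
    {I : Type*} [LinearOrder I] {α : Type*} (s : I → α → N) : Prop :=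
  ∀ (k : ℕ) (φ : L.Formula (B ⊕ (Fin k × α))) (i j : Fin k ↪o I),
    φ.Realize (Sum.elim (fun b => (b : N)) (fun q => s (i q.1) q.2)) ↔
      φ.Realize (Sum.elim (fun b => (b : N)) (fun q => s (j q.1) q.2))

/-- All the elements of `N` that occur as a coordinate of a tuple of the sequence `s`. -/
def seqEntries {N : Type*} {I : Type*} {α : Type*} (s : I → α → N) : Set N :=
  {b | ∃ (t : I) (c : α), s t c = b}

/-- The sequences `s i` are mutually indiscernible over `B`: each of them is indiscernible over
`B` together with all the other sequences. -/
def MutuallyIndiscernibleOver (L : Language.{u, v}) {N : Type*} [L.Structure N] (B : Set N)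
    {ι : Type*} {I : ι → Type*} [∀ i, LinearOrder (I i)] {α : ι → Type*}
    (s : ∀ i, I i → α i → N) : Prop :=
  ∀ i, L.IndiscernibleOver (B ∪ ⋃ (j : ι) (_ : j ≠ i), seqEntries (s j)) (s i)

/-- A (partial) type over `A ⊆ M` in `n` variables: a set of formulas in these variables with
parameters in `A`. -/
abbrev TypeOver (L : Language.{u, v}) {M : Type w} [L.Structure M] (A : Set M) (n : ℕ) :=
  Set (L.Formula (A ⊕ Fin n))

/-- The tuple `a` of the elementary extension `f : M → N` realizes the type `p`. -/
def TypeOver.RealizedBy {L : Language.{u, v}} {M : Type w} [L.Structure M] {A : Set M} {n : ℕ}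
    (p : L.TypeOver A n) {N : Type*} [L.Structure N] (f : M ↪ₑ[L] N) (a : Fin n → N) : Prop :=
  ∀ φ ∈ p, φ.Realize (Sum.elim (fun c : A => f c) a)

/-- `p` has dp-rank `< κ`: for every realization `a` of `p` and any `κ` infinite sequences that are
mutually indiscernible over `A`, at least one of them is indiscernible over `Aa`. The realization
and the sequences lie in an arbitrary elementary extension of `M`. The sequences are indexed by
arbitrary infinite linear orders and consist of tuples of arbitrary length, both of which may
vary with the sequence. -/
def TypeOver.DpRankLT {L : Language.{u, v}} {M : Type w} [L.Structure M] {A : Set M} {n : ℕ}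
    (p : L.TypeOver A n) (κ : Cardinal.{max u v w}) : Prop :=
  ∀ (N : Type (max u v w)) [L.Structure N] (f : M ↪ₑ[L] N) (a : Fin n → N), p.RealizedBy f a →
    ∀ (ι : Type (max u v w)), #ι = κ →
    ∀ (I : ι → Type (max u v w)) [∀ i, LinearOrder (I i)] [∀ i, Infinite (I i)]
      (α : ι → Type (max u v w)) (s : ∀ i, I i → α i → N),
      L.MutuallyIndiscernibleOver (f '' A) s →
        ∃ i, L.IndiscernibleOver (f '' A ∪ Set.range a) (s i)

/-- `p` is independent, that is, its dp-rank is `∞`: it is `< κ` for no cardinal `κ`. -/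
def TypeOver.IsIndependent {L : Language.{u, v}} {M : Type w} [L.Structure M] {A : Set M} {n : ℕ}
    (p : L.TypeOver A n) : Prop :=
  ∀ κ : Cardinal.{max u v w}, ¬ p.DpRankLT κ

/-- The cardinal `|T|` of a complete theory `T` in the language `L`: the number of
`L`-formulas, which is `|L| + ℵ₀`. -/
noncomputable def theoryCard (L : Language.{u, v}) : Cardinal.{max u v} :=
  max L.card ℵ₀

end FirstOrder.Language

-- The roles of the separating tuple and of the sequences are exchanged twice. Let `c` be the
-- successor of `max |T| |A|`, a regular cardinal. Independence gives a realization `a` of `p` and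
-- `c` sequences mutually indiscernible over `A`, none of them indiscernible over `Aa`; by
-- pigeonhole, infinitely many of the failures are due to one formula `φ`. Since tuples can be
-- replaced in all the sequences simultaneously, compactness yields `x j` with the type of `a` and
-- `b W` taken from the sequences such that `φ(x j, b W)` holds iff `j ∈ W`
-- (`exists_dual_sequence`). From the `x j` one extracts an indiscernible sequence of length `c` on
-- which some `φ(·, b)` defines a set unbounded with unbounded complement
-- (`exists_indiscernible_with_pattern`), so no tail is indiscernible over `b`.
--
-- Now the pieces of `b` are added to the parameters one by one. At some moment a single piece
-- destroys eventual indiscernibility. A tail that is indiscernible before that moment contains `c`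
-- successive blocks of order type `ω`, mutually indiscernible over the parameters so far and none
-- indiscernible over the new piece (`IndiscernibleOver.exists_blocks`).
--
-- After the first exchange the sequences consist of realizations of `p` and the separating piece is
-- a single element. After the second the sequences consist of single elements, and the separating
-- piece realizes `p`, because `b` inherits whatever holds of all terms of the sequences. Only
-- finitely many parameters are added on the way.

namespace FirstOrder.Language

-- Finite support of formulas

section Support

variable {L : Language.{u, v}} {N : Type*} [L.Structure N]

open Classical in
/-- The truth value of a formula depends only on finitely many variables. -/
theorem exists_finset_realize_congr {V : Type*} (φ : L.Formula V) :
    ∃ F : Finset V, ∀ v v' : V → N, (∀ x ∈ F, v x = v' x) → (φ.Realize v ↔ φ.Realize v') := by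
  refine ⟨BoundedFormula.freeVarFinset φ, fun v v' h => ?_⟩
  have h1 := BoundedFormula.realize_restrictFreeVar (φ := φ) (f := id) (v := fun x => v x)
    (xs := default) v (fun _ => rfl)
  have h2 := BoundedFormula.realize_restrictFreeVar (φ := φ) (f := id) (v := fun x => v x)
    (xs := default) v' (fun a => h a.1 a.2)
  exact h1.symm.trans h2

/-- A finite conjunction of formulas, existentially quantified over finitely many variables, is
a formula. -/
theorem exists_formula_exists_forall_realize {V γ ι : Type*} [Finite γ] [Finite ι]
    (Γ : ι → L.Formula (V ⊕ γ)) :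
    ∃ ψ : L.Formula V, ∀ v : V → N,
      ψ.Realize v ↔ ∃ a : γ → N, ∀ i, (Γ i).Realize (Sum.elim v a) :=
  ⟨(Formula.iInf Γ).iExs γ, fun v => by
    simp only [Formula.realize_iExs, Formula.realize_iInf]⟩

end Support

-- Indiscernibility over indexed parameters

section Family

variable (L : Language.{u, v}) {N : Type*} [L.Structure N]

/-- Indiscernibility over a family of parameters. -/
def IndiscernibleOverFam {P : Type*} (e : P → N) {I : Type*} [LinearOrder I] {α : Type*}
    (s : I → α → N) : Prop :=
  ∀ (k : ℕ) (φ : L.Formula (P ⊕ (Fin k × α))) (i j : Fin k ↪o I),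
    φ.Realize (Sum.elim e (fun q => s (i q.1) q.2)) ↔
      φ.Realize (Sum.elim e (fun q => s (j q.1) q.2))

variable {L} {I : Type*} [LinearOrder I] {α : Type*} {s : I → α → N}

theorem IndiscernibleOverFam.of_range_subset {P P' : Type*} {e : P → N} {e' : P' → N}
    (h : L.IndiscernibleOverFam e s) (hee : Set.range e' ⊆ Set.range e) :
    L.IndiscernibleOverFam e' s := by
  intro k φ i j
  choose g hg using fun p => hee (Set.mem_range_self p)
  have := h k (φ.relabel (Sum.map g id)) i j
  simp only [Formula.realize_relabel, Sum.elim_comp_map, Function.comp_id] at this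
  rwa [show e ∘ g = e' from funext hg] at this

theorem indiscernibleOver_iff_fam {P : Type*} {e : P → N} {B : Set N} (h : Set.range e = B) :
    L.IndiscernibleOver B s ↔ L.IndiscernibleOverFam e s := by
  have h1 : L.IndiscernibleOver B s ↔ L.IndiscernibleOverFam (fun b : B => (b : N)) s := Iff.rfl
  rw [h1]
  constructor <;> intro h2 <;> apply h2.of_range_subset <;> simp [h]

theorem IndiscernibleOver.mono {B B' : Set N} (h : L.IndiscernibleOver B s) (hB : B' ⊆ B) :
    L.IndiscernibleOver B' s :=
  IndiscernibleOverFam.of_range_subset (e := fun b : B => (b : N)) h (by simpa using hB)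

theorem IndiscernibleOver.comp {B : Set N} {I' β : Type*} [LinearOrder I']
    (h : L.IndiscernibleOver B s) (g : I' ↪o I) (c : β → α) :
    L.IndiscernibleOver B (fun t b => s (g t) (c b)) := by
  intro k φ i j
  have := h k (φ.relabel (Sum.map id (Prod.map id c))) (i.trans g) (j.trans g)
  simp only [Formula.realize_relabel, Sum.elim_comp_map, Function.comp_id] at this
  exact this

/-- Indiscernibility for tuples of indices that need not be increasing. -/
theorem IndiscernibleOverFam.realize_iff_of_lt_iff {P V : Type*} {e : P → N}
    (h : L.IndiscernibleOverFam e s) (φ : L.Formula (P ⊕ (V × α))) (g g' : V → I)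
    (hg : ∀ x y, g x < g y ↔ g' x < g' y) :
    φ.Realize (Sum.elim e (fun q => s (g q.1) q.2)) ↔
      φ.Realize (Sum.elim e (fun q => s (g' q.1) q.2)) := by
  classical
  have heq : ∀ x y, g x = g y ↔ g' x = g' y := fun x y => by
    have h1 := hg x y
    have h2 := hg y x
    constructor <;> intro h3
    · rw [h3] at h1 h2
      simp only [lt_irrefl, false_iff, not_lt] at h1 h2
      exact le_antisymm h2 h1
    · rw [h3] at h1 h2
      simp only [lt_irrefl, iff_false, not_lt] at h1 h2
      exact le_antisymm h2 h1
  rcases isEmpty_or_nonempty V with hV | ⟨⟨x0⟩⟩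
  · rw [show g = g' from funext fun x => hV.elim x]
  obtain ⟨F, hF⟩ := exists_finset_realize_congr (N := N) φ
  let G : Finset V := F.biUnion (fun x => Sum.elim (fun _ => ∅) (fun q => {q.1}) x)
  have hG : ∀ x c, Sum.inr (x, c) ∈ F → x ∈ G := fun x c hx =>
    Finset.mem_biUnion.2 ⟨_, hx, by simp⟩
  let K := G.image g
  have hK : ∀ y : K, ∃ x ∈ G, g x = y := fun y => by
    simpa only [K, Finset.mem_image] using y.2
  choose r hr hr' using hK
  -- `i` lists the values of `g` on the support in increasing order and `j` the corresponding values
  -- of `g'`; below, `ρ` factors both through these lists.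
  let i : Fin K.card ↪o I := K.orderEmbOfFin rfl
  let j : Fin K.card ↪o I := OrderEmbedding.ofStrictMono
    (fun q => g' (r (K.orderIsoOfFin rfl q))) (fun a b hab => by
      rw [← hg, hr', hr']
      exact (K.orderIsoOfFin rfl).strictMono hab)
  have hne : ∀ x ∈ G, g x ∈ K := fun x hx => Finset.mem_image_of_mem _ hx
  by_cases hGe : ∃ x, x ∈ G
  swap
  · apply hF
    rintro (p | ⟨x, c⟩) hx
    · rfl
    · exact absurd ⟨x, hG x c hx⟩ hGe
  obtain ⟨x1, hx1⟩ := hGe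
  let ρ : V → Fin K.card := fun x =>
    if hx : x ∈ G then (K.orderIsoOfFin rfl).symm ⟨g x, hne x hx⟩
    else (K.orderIsoOfFin rfl).symm ⟨g x1, hne x1 hx1⟩
  have hi : ∀ x ∈ G, i (ρ x) = g x := fun x hx => by
    simp only [ρ, dif_pos hx, i, ← Finset.coe_orderIsoOfFin_apply, OrderIso.apply_symm_apply]
  have hj : ∀ x ∈ G, j (ρ x) = g' x := fun x hx => by
    change g' (r (K.orderIsoOfFin rfl (ρ x))) = g' x
    rw [← heq, hr']
    simp only [ρ, dif_pos hx, OrderIso.apply_symm_apply]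
  have key := h K.card (φ.relabel (Sum.map id (Prod.map ρ id))) i j
  simp only [Formula.realize_relabel, Sum.elim_comp_map, Function.comp_id] at key
  refine Iff.trans (hF _ _ ?_) (key.trans (hF _ _ ?_))
  · rintro (p | ⟨x, c⟩) hx
    · rfl
    · simp [hi x (hG x c hx)]
  · rintro (p | ⟨x, c⟩) hx
    · rfl
    · simp [hj x (hG x c hx)]

end Family

-- Mutually indiscernible sequences

section Mutual

variable {L : Language.{u, v}} {N : Type*} [L.Structure N]

theorem MutuallyIndiscernibleOver.comp {B : Set N} {ι : Type*} {I : ι → Type*}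
    [∀ i, LinearOrder (I i)] {α : ι → Type*} {s : ∀ i, I i → α i → N}
    (h : L.MutuallyIndiscernibleOver B s) {ι' : Type*} (f : ι' → ι) (hf : f.Injective)
    {β : ι' → Type*} (c : ∀ i, β i → α (f i)) :
    L.MutuallyIndiscernibleOver B (fun i t b => s (f i) t (c i b)) := by
  intro i
  refine ((h (f i)).comp (RelEmbedding.refl _) (c i)).mono ?_
  refine Set.union_subset_union_right _ (Set.iUnion₂_subset fun j hj => ?_)
  rintro _ ⟨t, b, rfl⟩
  exact Set.mem_iUnion₂.2 ⟨f j, hf.ne hj, t, _, rfl⟩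

/-- In mutually indiscernible sequences, increasing tuples may be replaced simultaneously in all
the sequences. -/
theorem MutuallyIndiscernibleOver.realize_iff {B : Set N} {ι : Type*} {I : ι → Type*}
    [∀ i, LinearOrder (I i)] {α : Type*} {s : ∀ i, I i → α → N}
    (h : L.MutuallyIndiscernibleOver B s) {k : ℕ} (φ : L.Formula (B ⊕ (ι × Fin k × α)))
    (w w' : ∀ i, Fin k ↪o I i) :
    φ.Realize (Sum.elim (fun b => (b : N)) (fun q => s q.1 (w q.1 q.2.1) q.2.2)) ↔
      φ.Realize (Sum.elim (fun b => (b : N)) (fun q => s q.1 (w' q.1 q.2.1) q.2.2)) := by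
  classical
  have step : ∀ (w : ∀ i, Fin k ↪o I i) (i : ι) (z : Fin k ↪o I i),
      φ.Realize (Sum.elim (fun b => (b : N)) (fun q => s q.1 (w q.1 q.2.1) q.2.2)) ↔
      φ.Realize (Sum.elim (fun b => (b : N))
        (fun q => s q.1 (Function.update w i z q.1 q.2.1) q.2.2)) := by
    intro w i z
    let C : Set N := B ∪ ⋃ (j : ι) (_ : j ≠ i), seqEntries (s j)
    have hC : ∀ (j : ι) (_ : j ≠ i) (q : Fin k × α), s j (w j q.1) q.2 ∈ C := fun j hj q =>
      Or.inr (Set.mem_iUnion₂.2 ⟨j, hj, _, _, rfl⟩)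
    -- Entries of the sequences other than `s i` become parameters.
    let ρ : B ⊕ (ι × Fin k × α) → C ⊕ (Fin k × α) :=
      Sum.elim (fun b => Sum.inl ⟨b, Or.inl b.2⟩)
        (fun q => if hq : q.1 = i then Sum.inr q.2 else Sum.inl ⟨_, hC q.1 hq q.2⟩)
    have := h i k (φ.relabel ρ) (w i) z
    simp only [Formula.realize_relabel] at this
    convert this using 2
    · ext (b | ⟨j, q⟩)
      · rfl
      · by_cases hj : j = i
        · subst hj
          simp [ρ]
        · simp [ρ, hj]
    · ext (b | ⟨j, q⟩)
      · rfl
      · by_cases hj : j = i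
        · subst hj
          simp [ρ]
        · simp [ρ, hj]
  obtain ⟨F, hF⟩ := exists_finset_realize_congr (N := N) φ
  have ind : ∀ G : Finset ι,
      φ.Realize (Sum.elim (fun b => (b : N)) (fun q => s q.1 (w q.1 q.2.1) q.2.2)) ↔
      φ.Realize (Sum.elim (fun b => (b : N))
        (fun q => s q.1 (G.piecewise w' w q.1 q.2.1) q.2.2)) := by
    intro G
    induction G using Finset.induction_on with
    | empty => simp
    | insert i G _ ih =>
      rw [ih, step _ i (w' i), Finset.piecewise_insert]
  rw [ind (F.biUnion (fun x => Sum.elim (fun _ => ∅) (fun q => {q.1}) x))]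
  apply hF
  rintro (b | ⟨j, q⟩) hx
  · rfl
  · have : j ∈ F.biUnion (fun x => Sum.elim (fun _ => ∅) (fun q => {q.1}) x) :=
      Finset.mem_biUnion.2 ⟨_, hx, by simp⟩
    simp only [Sum.elim_inr, Finset.piecewise, if_pos this]

/-- Pairwise separated blocks of an indiscernible sequence are mutually indiscernible. -/
theorem IndiscernibleOver.mutually_of_blocks {B : Set N} {O : Type*} [LinearOrder O] {α : Type*}
    {s : O → α → N} (h : L.IndiscernibleOver B s) {ι : Type*} [LinearOrder ι] {I : Type*}
    [LinearOrder I] (J : ι → I ↪o O) (hJ : ∀ l l', l < l' → ∀ t t', J l t < J l' t') :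
    L.MutuallyIndiscernibleOver B (fun l t => s (J l t)) := by
  intro l
  let P := B ⊕ ({j : ι // j ≠ l} × I × α)
  let e : P → N := Sum.elim (fun b => (b : N)) (fun q => s (J q.1 q.2.1) q.2.2)
  refine (indiscernibleOver_iff_fam (e := e) ?_).2 ?_
  · ext x
    simp only [e, Set.Sum.elim_range, Subtype.range_coe_subtype, Set.ofPred_mem_eq, Set.mem_union,
      Set.mem_range, Set.mem_iUnion, seqEntries, Set.mem_ofPred_eq, Prod.exists, Subtype.exists,
      P]
  intro k φ i j
  let V := ({j : ι // j ≠ l} × I) ⊕ Fin k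
  let ρ : P ⊕ (Fin k × α) → B ⊕ (V × α) :=
    Sum.elim (Sum.elim Sum.inl (fun q => Sum.inr (Sum.inl (q.1, q.2.1), q.2.2)))
      (fun q => Sum.inr (Sum.inr q.1, q.2))
  let g : (Fin k ↪o I) → V → O := fun i => Sum.elim (fun q => J q.1 q.2) (fun q => J l (i q))
  have := IndiscernibleOverFam.realize_iff_of_lt_iff (V := V) h (φ.relabel ρ) (g i) (g j) ?_
  · simp only [Formula.realize_relabel] at this
    convert this using 2
    · ext ((b | q) | q) <;> rfl
    · ext ((b | q) | q) <;> rfl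
  -- Any other block lies wholly on one side of block `l`, so moving points inside block `l` changes
  -- no order relation with it.
  · have h1 : ∀ (m : {j : ι // j ≠ l}) t t' t'', J m t < J l t' ↔ J m t < J l t'' := by
      intro m t t' t''
      rcases lt_or_gt_of_ne m.2 with hm | hm
      · simp [hJ _ _ hm]
      · simp [(hJ _ _ hm _ _).not_gt]
    have h2 : ∀ (m : {j : ι // j ≠ l}) t t' t'', J l t' < J m t ↔ J l t'' < J m t := by
      intro m t t' t''
      rcases lt_or_gt_of_ne m.2 with hm | hm
      · simp [(hJ _ _ hm _ _).not_gt]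
      · simp [hJ _ _ hm]
    rintro (x | x) (y | y)
    · rfl
    · exact h1 _ _ _ _
    · exact h2 _ _ _ _
    · simp [g]

end Mutual

-- Compactness through ultrapowers

section Extension

variable {L : Language.{u, v}} {N : Type w} [L.Structure N] [Nonempty N]

open Filter in
/-- For a family of valuations in `N` and a filter on its index set, some elementary extension of
`N` has a valuation which satisfies all the formulas that hold eventually. -/
theorem exists_elementaryEmbedding_of_filter {X : Type w} (F : Filter X) [F.NeBot] {V : Type*}
    (val : X → V → N) :
    ∃ (N' : Type w) (_ : L.Structure N') (f : N ↪ₑ[L] N') (v : V → N'),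
      ∀ φ : L.Formula (N ⊕ V), (∀ᶠ x in F, φ.Realize (Sum.elim id (val x))) →
        φ.Realize (Sum.elim f v) := by
  let U : Ultrafilter X := Ultrafilter.of F
  let N' := (U : Filter X).Product (fun _ : X => N)
  let d : N → N' := fun a => ((fun _ => a : X → N) : N')
  refine ⟨N', inferInstance, ⟨d, fun n φ x => ?_⟩, fun q => ((fun x => val x q : X → N) : N'),
    fun φ hφ => ?_⟩
  · have := Ultraproduct.realize_formula_cast (M := fun _ : X => N) (u := U) φ
      (fun i _ => x i)
    exact this.trans eventually_const
  · have := Ultraproduct.realize_formula_cast (M := fun _ : X => N) (u := U) φ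
      (fun q x => Sum.elim id (val x) q)
    refine Iff.mp ?_ (this.2 (Ultrafilter.of_le F hφ))
    refine iff_of_eq (congrArg _ ?_)
    ext (a | q) <;> rfl

end Extension

-- Generic tuples for an iterated ultrafilter

section IteratedUltrafilter

open Filter

/-- The filter on `r`-tuples obtained by iterating the quantifier `∀ᶠ i in U`. -/
def iteratedFilter (U : Filter ℕ) : (r : ℕ) → Filter (Fin r → ℕ)
  | 0 => pure Fin.elim0
  | r + 1 => U.bind fun i => (iteratedFilter U r).map fun t => (Fin.cons i t : Fin (r + 1) → ℕ)

theorem eventually_iteratedFilter_succ {U : Filter ℕ} {r : ℕ} {p : (Fin (r + 1) → ℕ) → Prop} :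
    (∀ᶠ t in iteratedFilter U (r + 1), p t) ↔
      ∀ᶠ i in U, ∀ᶠ t in iteratedFilter U r, p (Fin.cons i t) := by
  rw [iteratedFilter, eventually_bind]
  rfl

/-- This dichotomy stands in for Ramsey's theorem: every formula is decided on generic tuples, and
their type is that of an indiscernible sequence. -/
theorem eventually_iteratedFilter_or_not (U : Ultrafilter ℕ) (r : ℕ) (p : (Fin r → ℕ) → Prop) :
    (∀ᶠ t in iteratedFilter U r, p t) ∨ ∀ᶠ t in iteratedFilter U r, ¬ p t := by
  induction r with
  | zero => exact by simpa [iteratedFilter] using em (p Fin.elim0)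
  | succ r ih =>
    simp only [eventually_iteratedFilter_succ]
    rw [← Ultrafilter.eventually_or]
    exact Eventually.of_forall fun i => ih _

instance iteratedFilter_neBot (U : Filter ℕ) [U.NeBot] (r : ℕ) : (iteratedFilter U r).NeBot := by
  induction r with
  | zero => rw [iteratedFilter]; exact pure_neBot
  | succ r ih =>
    rw [neBot_iff, Ne, ← eventually_false_iff_eq_bot, eventually_iteratedFilter_succ]
    simp only [eventually_const, not_false_eq_true]

/-- Coordinates outside the range of `h` are dummy variables of the iterated quantifier. Hence what
is generic on a tuple of indices does not depend on the larger finite set in which it is placed. -/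
theorem eventually_iteratedFilter_comp {U : Filter ℕ} {k r : ℕ} {h : Fin r → Fin k}
    (hh : StrictMono h) {p : (Fin r → ℕ) → Prop} (hp : ∀ᶠ t in iteratedFilter U r, p t) :
    ∀ᶠ t in iteratedFilter U k, p (t ∘ h) := by
  induction k generalizing r with
  | zero =>
    cases r with
    | zero => exact hp.mono fun t ht => by rwa [Subsingleton.elim (t ∘ h) t]
    | succ r => exact (h 0).elim0
  | succ k ih =>
    rw [eventually_iteratedFilter_succ]
    -- If `h` takes the value `0`, the outermost quantifiers of the two sides match; otherwise the
    -- outermost one on the `k` side is a dummy.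
    by_cases h0 : ∃ l : Fin r, h l = 0
    · cases r with
      | zero => exact h0.choose.elim0
      | succ r =>
        have h00 : h 0 = 0 := by
          obtain ⟨l, hl⟩ := h0
          exact le_antisymm (hl ▸ hh.monotone (Fin.zero_le l)) (Fin.zero_le _)
        have hne : ∀ l : Fin r, h l.succ ≠ 0 := fun l =>
          (h00 ▸ hh (Fin.succ_pos l) : 0 < h l.succ).ne'
        rw [eventually_iteratedFilter_succ] at hp
        filter_upwards [hp] with i hi
        have hm : StrictMono (fun l : Fin r => (h l.succ).pred (hne l)) := fun a b hab => by
          rw [Fin.pred_lt_pred_iff]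
          exact hh (Fin.succ_lt_succ_iff.2 hab)
        refine (ih hm hi).mono fun t ht => ?_
        convert ht using 1
        ext l
        refine Fin.cases ?_ (fun l => ?_) l
        · simp [h00]
        · simp only [Function.comp_apply, Fin.cons_succ]
          conv_lhs => rw [← Fin.succ_pred (h l.succ) (hne l), Fin.cons_succ]
    · push Not at h0
      have hm : StrictMono (fun l : Fin r => (h l).pred (h0 l)) := fun a b hab => by
        rw [Fin.pred_lt_pred_iff]
        exact hh hab
      refine Eventually.of_forall fun i => (ih hm hp).mono fun t ht => ?_
      convert ht using 1
      ext l
      simp only [Function.comp_apply]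
      conv_lhs => rw [← Fin.succ_pred (h l) (h0 l), Fin.cons_succ]

theorem eventually_iteratedFilter_forall {U : Filter ℕ} {p : ℕ → Prop} (hp : ∀ᶠ i in U, p i)
    (r : ℕ) : ∀ᶠ t in iteratedFilter U r, ∀ l, p (t l) := by
  induction r with
  | zero => exact Eventually.of_forall fun t l => l.elim0
  | succ r ih =>
    rw [eventually_iteratedFilter_succ]
    filter_upwards [hp] with i hi
    filter_upwards [ih] with t ht l
    exact Fin.cases hi ht l

theorem eventually_iteratedFilter_injective {U : Filter ℕ} (hU : U ≤ cofinite) (r : ℕ) :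
    ∀ᶠ t in iteratedFilter U r, Function.Injective t := by
  induction r with
  | zero => exact Eventually.of_forall fun t l => l.elim0
  | succ r ih =>
    rw [eventually_iteratedFilter_succ]
    refine Eventually.of_forall fun i => ?_
    have h1 : ∀ᶠ j in U, j ≠ i := hU (Set.finite_singleton i).compl_mem_cofinite
    filter_upwards [ih, eventually_iteratedFilter_forall h1 r] with t ht ht'
    rw [Fin.cons_injective_iff]
    exact ⟨fun ⟨l, hl⟩ => ht' l hl, ht⟩

end IteratedUltrafilter

-- Exchanging the separating tuple and the sequences

section Dual

open Filter

variable {L : Language.{u, v}} {N : Type (max u v w)} [L.Structure N]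

/-- If `a` separates two increasing tuples in each of a family of mutually indiscernible sequences,
uniformly by the formula `φ`, then the realizations of the type of `a` are cut arbitrarily by
instances of `φ`: there is a sequence of realizations of the type of `a`, all of whose finite
sets of indices are defined by `φ` with parameters in the given sequences. -/
theorem MutuallyIndiscernibleOver.exists_dual_sequence [Nonempty N] {B : Set N} {γ α : Type}
    [Finite γ] (a : γ → N) {I : Finset ℕ → Type*} [∀ W, LinearOrder (I W)] {s : ∀ W, I W → α → N}
    (hs : L.MutuallyIndiscernibleOver B s) {k : ℕ} (φ : L.Formula ((B ⊕ γ) ⊕ (Fin k × α)))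
    (y z : ∀ W, Fin k ↪o I W)
    (hy : ∀ W, φ.Realize
      (Sum.elim (Sum.elim (fun b => (b : N)) a) (fun q => s W (y W q.1) q.2)))
    (hz : ∀ W, ¬ φ.Realize
      (Sum.elim (Sum.elim (fun b => (b : N)) a) (fun q => s W (z W q.1) q.2))) :
    ∃ (N' : Type (max u v w)) (_ : L.Structure N') (f : N ↪ₑ[L] N') (x : ℕ → γ → N'),
      (∀ j W, φ.Realize (Sum.elim (Sum.elim (fun b : B => f b) (x j))
        (fun q => f (s W (y W q.1) q.2))) ↔ j ∈ W) ∧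
      ∀ j (θ : L.Formula (B ⊕ γ)), θ.Realize (Sum.elim (fun b => (b : N)) a) →
        θ.Realize (Sum.elim (fun b : B => f b) (x j)) := by
  classical
  let T := {θ : L.Formula (B ⊕ γ) // θ.Realize (Sum.elim (fun b => (b : N)) a)}
  have fin : ∀ (D : Finset (Finset ℕ) × Finset T) (j : ℕ), ∃ a' : γ → N,
      (∀ W ∈ D.1, (φ.Realize (Sum.elim (Sum.elim (fun b : B => (b : N)) a')
        (fun q => s W (y W q.1) q.2)) ↔ j ∈ W)) ∧
      ∀ θ ∈ D.2, θ.1.Realize (Sum.elim (fun b => (b : N)) a') := by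
    intro D j
    let ρ : Finset ℕ → (B ⊕ γ) ⊕ (Fin k × α) → (B ⊕ (Finset ℕ × Fin k × α)) ⊕ γ := fun W =>
      Sum.elim (Sum.map Sum.inl id) (fun q => Sum.inl (Sum.inr (W, q)))
    obtain ⟨ψ, hψ⟩ := exists_formula_exists_forall_realize (L := L) (N := N)
      (V := B ⊕ (Finset ℕ × Fin k × α)) (γ := γ) (ι := D.1 ⊕ D.2)
      (Sum.elim (fun W => (if j ∈ W.1 then φ else φ.not).relabel (ρ W))
        (fun θ => θ.1.1.relabel (Sum.map Sum.inl id)))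
    -- The tuple `a` itself witnesses `ψ` when `y W` is replaced by `z W` for all `W` not containing
    -- `j`; mutual indiscernibility transfers `ψ` to the tuples `y W`, and its new witness is `a'`.
    have key := hs.realize_iff ψ (fun W => if j ∈ W then y W else z W) y
    have h1 := key.1 ((hψ _).2 ⟨a, ?_⟩)
    · obtain ⟨a', ha'⟩ := (hψ _).1 h1
      refine ⟨a', fun W hW => ?_, fun θ hθ => ?_⟩
      · have := ha' (Sum.inl ⟨W, hW⟩)
        simp only [Sum.elim_inl, Formula.realize_relabel] at this
        have hv : (Sum.elim (Sum.elim (fun b : B => (b : N))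
            (fun q : Finset ℕ × Fin k × α => s q.1 (y q.1 q.2.1) q.2.2)) a' ∘ ρ W) =
            Sum.elim (Sum.elim (fun b : B => (b : N)) a') (fun q => s W (y W q.1) q.2) := by
          ext ((b | c) | q) <;> rfl
        rw [hv] at this
        by_cases hj : j ∈ W
        · simpa [hj] using this
        · simpa [hj] using this
      · have := ha' (Sum.inr ⟨θ, hθ⟩)
        simp only [Sum.elim_inr, Formula.realize_relabel] at this
        convert this using 1
        ext (b | c) <;> rfl
    · rintro (⟨W, hW⟩ | ⟨θ, hθ⟩)
      · simp only [Sum.elim_inl, Formula.realize_relabel]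
        by_cases hj : j ∈ W
        · simp only [hj, if_true]
          convert hy W using 1
          ext ((b | c) | q)
          · rfl
          · rfl
          · simp [ρ, hj]
        · simp only [hj, if_false, Formula.realize_not]
          convert hz W using 2
          ext ((b | c) | q)
          · rfl
          · rfl
          · simp [ρ, hj]
      · simp only [Sum.elim_inr, Formula.realize_relabel]
        convert θ.2 using 1
        ext (b | c) <;> rfl
  choose x hx1 hx2 using fin
  obtain ⟨N', _, f, x', h⟩ := exists_elementaryEmbedding_of_filter (L := L) (N := N)
    (X := Finset (Finset ℕ) × Finset T) atTop (V := ℕ × γ) (fun D q => x D q.1 q.2)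
  have hW : ∀ j W (χ : L.Formula ((B ⊕ γ) ⊕ (Fin k × α))),
      (∀ᶠ D in (atTop : Filter (Finset (Finset ℕ) × Finset T)), χ.Realize (Sum.elim
        (Sum.elim (fun b : B => (b : N)) (x D j)) (fun q => s W (y W q.1) q.2))) →
      χ.Realize (Sum.elim (Sum.elim (fun b : B => f b) (fun c => x' (j, c)))
        (fun q => f (s W (y W q.1) q.2))) := by
    intro j W χ hχ
    have := h (χ.relabel (Sum.elim (Sum.map (fun b : B => (b : N)) (fun c => (j, c)))
      (fun q : Fin k × α => Sum.inl (s W (y W q.1) q.2)))) (by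
        refine hχ.mono fun D hD => ?_
        simp only [Formula.realize_relabel]
        convert hD using 1
        ext ((b | c) | q) <;> rfl)
    simp only [Formula.realize_relabel] at this
    convert this using 1
    ext ((b | c) | q) <;> rfl
  refine ⟨N', inferInstance, f, fun j c => x' (j, c), fun j W => ?_, fun j θ hθ => ?_⟩
  · have hev : ∀ᶠ D in (atTop : Filter (Finset (Finset ℕ) × Finset T)), W ∈ D.1 :=
      (eventually_ge_atTop (({W}, ∅) : Finset (Finset ℕ) × Finset T)).mono fun D hD => hD.1 (by simp)
    by_cases hj : j ∈ W
    · simp only [hj, iff_true]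
      exact hW j W φ (hev.mono fun D hD => (hx1 D j W hD).2 hj)
    · simp only [hj, iff_false]
      exact hW j W φ.not (hev.mono fun D hD => fun hc => hj ((hx1 D j W hD).1 hc))
  · have hev : ∀ᶠ D in (atTop : Filter (Finset (Finset ℕ) × Finset T)), ⟨θ, hθ⟩ ∈ D.2 :=
      (eventually_ge_atTop ((∅, {⟨θ, hθ⟩}) : Finset (Finset ℕ) × Finset T)).mono
        fun D hD => hD.2 (by simp)
    have := h (θ.relabel (Sum.map (fun b : B => (b : N)) (fun c => (j, c)))) (by
      refine hev.mono fun D hD => ?_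
      simp only [Formula.realize_relabel]
      convert hx2 D j _ hD using 1
      ext (b | c) <;> rfl)
    simp only [Formula.realize_relabel] at this
    convert this using 1
    ext (b | c) <;> rfl

end Dual

-- Extraction of an indiscernible sequence with a prescribed cut

section EhrenfeuchtMostowski

open Filter

variable {L : Language.{u, v}} {N : Type w} [L.Structure N]

/-- A sequence whose finite sets of indices are all defined by instances of `φ` gives rise to an
indiscernible sequence, of any order type, on which some instance of `φ` defines a given set. -/
theorem exists_indiscernible_with_pattern {P γ β : Type*} (e : P → N) (x : ℕ → γ → N)
    (φ : L.Formula ((P ⊕ γ) ⊕ β)) (b : Finset ℕ → β → N)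
    (hφ : ∀ j W, φ.Realize (Sum.elim (Sum.elim e (x j)) (b W)) ↔ j ∈ W)
    [Nonempty N] (O : Type w) [LinearOrder O] (Q : Set O) :
    ∃ (N' : Type w) (_ : L.Structure N') (f : N ↪ₑ[L] N') (s : O → γ → N') (b' : β → N'),
      L.IndiscernibleOverFam (f ∘ e) s ∧
      (∀ t, φ.Realize (Sum.elim (Sum.elim (f ∘ e) (s t)) b') ↔ t ∈ Q) ∧
      (∀ θ : L.Formula (P ⊕ γ), (∀ j, θ.Realize (Sum.elim e (x j))) →
        ∀ t, θ.Realize (Sum.elim (f ∘ e) (s t))) ∧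
      ∀ θ : L.Formula (P ⊕ β), (∀ W, θ.Realize (Sum.elim e (b W))) →
        θ.Realize (Sum.elim (f ∘ e) b') := by
  classical
  let U : Ultrafilter ℕ := hyperfilter ℕ
  -- The default `0` is harmless: a given formula concerns finitely many indices, all of which lie
  -- in `K` once `K` is large.
  let E : (K : Finset O) → (Fin K.card → ℕ) → O → ℕ := fun K t o =>
    if ho : o ∈ K then t ((K.orderIsoOfFin rfl).symm ⟨o, ho⟩) else 0
  -- Choose a large finite `K`, then a generic tuple indexed by `K`, then any finite set that cuts
  -- this tuple exactly as `Q` cuts `K`.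
  let F : Filter ((O → ℕ) × Finset ℕ) := (atTop : Filter (Finset O)).bind fun K =>
    (iteratedFilter U K.card).bind fun t =>
      𝓟 {y | y.1 = E K t ∧ ∀ o ∈ K, E K t o ∈ y.2 ↔ o ∈ Q}
  have hF : ∀ p : (O → ℕ) × Finset ℕ → Prop, (∀ᶠ y in F, p y) ↔
      ∀ᶠ K : Finset O in atTop, ∀ᶠ t in iteratedFilter U K.card,
        ∀ W : Finset ℕ, (∀ o ∈ K, E K t o ∈ W ↔ o ∈ Q) → p (E K t, W) := by
    intro p
    simp only [F, eventually_bind, eventually_principal]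
    refine eventually_congr (Eventually.of_forall fun K =>
      eventually_congr (Eventually.of_forall fun t => ?_))
    constructor
    · exact fun h W hW => h _ ⟨rfl, hW⟩
    · rintro h ⟨_, W⟩ ⟨rfl, hW⟩
      exact h W hW
  have hE : ∀ K t, Function.Injective t → Set.InjOn (E K t) K := by
    intro K t ht o ho o' ho' h
    rw [Finset.mem_coe] at ho ho'
    simp only [E, dif_pos ho, dif_pos ho'] at h
    simpa using ht h
  have : F.NeBot := by
    rw [neBot_iff, Ne, ← eventually_false_iff_eq_bot, hF]
    intro hc
    obtain ⟨K, hK⟩ := hc.exists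
    obtain ⟨t, ht, ht'⟩ :=
      (hK.and (eventually_iteratedFilter_injective (U := U) hyperfilter_le_cofinite _)).exists
    -- Injectivity of the generic tuple guarantees that such a finite set exists, so the filter is
    -- proper.
    refine ht ((K.filter (· ∈ Q)).image (E K t)) fun o ho => ?_
    simp only [Finset.mem_image, Finset.mem_filter]
    constructor
    · rintro ⟨o', ⟨ho', hQ⟩, h⟩
      rwa [← hE K t ht' ho' ho h]
    · exact fun hQ => ⟨o, ⟨ho, hQ⟩, rfl⟩
  obtain ⟨N', _, f, d, h⟩ := exists_elementaryEmbedding_of_filter (L := L) (N := N) F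
    (V := (O × γ) ⊕ β) (fun y => Sum.elim (fun q => x (y.1 q.1) q.2) (b y.2))
  let s : O → γ → N' := fun t c => d (Sum.inl (t, c))
  let b' : β → N' := fun c => d (Sum.inr c)
  have hφ' : ∀ t (χ : L.Formula ((P ⊕ γ) ⊕ β)),
      (∀ j W, (j ∈ W ↔ t ∈ Q) → χ.Realize (Sum.elim (Sum.elim e (x j)) (b W))) →
      χ.Realize (Sum.elim (Sum.elim (f ∘ e) (s t)) b') := by
    intro t χ hχ
    have := h (χ.relabel (Sum.elim (Sum.map e (fun c => Sum.inl (t, c)))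
      (fun q => Sum.inr (Sum.inr q)))) (by
        rw [hF]
        filter_upwards [eventually_ge_atTop {t}] with K hK
        refine Eventually.of_forall fun g W hW => ?_
        simp only [Formula.realize_relabel]
        convert hχ (E K g t) W (hW t (hK (Finset.mem_singleton_self t))) using 1
        ext ((p | c) | q) <;> rfl)
    simp only [Formula.realize_relabel] at this
    convert this using 1
    ext ((p | c) | q) <;> rfl
  refine ⟨N', inferInstance, f, s, b', ?_, fun t => ?_, fun θ hθ t => ?_, fun θ hθ => ?_⟩
  · have em : ∀ (k : ℕ) (δ : L.Formula (P ⊕ (Fin k × γ))) (i : Fin k ↪o O),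
        (∀ᶠ t in iteratedFilter U k, δ.Realize (Sum.elim e (fun q => x (t q.1) q.2))) →
        δ.Realize (Sum.elim (f ∘ e) (fun q => s (i q.1) q.2)) := by
      intro k δ i hδ
      have := h (δ.relabel (Sum.map e (fun q => Sum.inl (i q.1, q.2)))) (by
        rw [hF]
        filter_upwards [eventually_ge_atTop (Finset.univ.map i.toEmbedding)] with K hK
        have hi : ∀ l, i l ∈ K := fun l => hK (Finset.mem_map_of_mem _ (Finset.mem_univ l))
        have hm : StrictMono (fun l => (K.orderIsoOfFin rfl).symm ⟨i l, hi l⟩) := fun l l' hl => by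
          rw [OrderIso.lt_iff_lt, Subtype.mk_lt_mk]
          exact i.strictMono hl
        refine (eventually_iteratedFilter_comp hm hδ).mono fun t ht W _ => ?_
        simp only [Formula.realize_relabel]
        convert ht using 1
        ext (p | q)
        · rfl
        · simp [E, hi])
      simp only [Formula.realize_relabel] at this
      convert this using 1
      ext (p | q) <;> rfl
    intro k δ i j
    rcases eventually_iteratedFilter_or_not U k
      (fun t => δ.Realize (Sum.elim e (fun q => x (t q.1) q.2))) with hδ | hδ
    · exact iff_of_true (em k δ i hδ) (em k δ j hδ)
    · exact iff_of_false (em k δ.not i hδ) (em k δ.not j hδ)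
  · by_cases ht : t ∈ Q
    · refine iff_of_true (hφ' t φ fun j W hj => (hφ j W).2 (hj.2 ht)) ht
    · refine iff_of_false (hφ' t φ.not fun j W hj hc => ht (hj.1 ((hφ j W).1 hc))) ht
  · have := hφ' t (θ.relabel Sum.inl) (fun j W _ => by
      simpa only [Formula.realize_relabel, Sum.elim_comp_inl] using hθ j)
    simpa only [Formula.realize_relabel, Sum.elim_comp_inl] using this
  · have := h (θ.relabel (Sum.map e Sum.inr)) (by
      refine Eventually.of_forall fun y => ?_
      simp only [Formula.realize_relabel]
      convert hθ y.2 using 1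
      ext (p | q) <;> rfl)
    simp only [Formula.realize_relabel] at this
    convert this using 1
    ext (p | q) <;> rfl

end EhrenfeuchtMostowski

-- From mutually indiscernible sequences to one long sequence

section Combination

variable {L : Language.{u, v}} {N : Type (max u v w)}

/-- There are fewer possible separating formulas than sequences, as the pigeonhole argument
requires. -/
theorem card_sigma_formula_lt {B : Set N} {γ α : Type} [Finite γ] [Finite α]
    {c : Cardinal.{max u v w}} (hL : Cardinal.lift.{w} L.theoryCard < c) (hB : #B < c) :
    #(Σ k : ℕ, L.Formula ((B ⊕ γ) ⊕ (Fin k × α))) < c := by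
  set μ : Cardinal.{max u v w} := max (Cardinal.lift.{w} L.theoryCard) #B with hμ
  have hL0 : ℵ₀ ≤ Cardinal.lift.{w} L.theoryCard := aleph0_le_lift.2 (le_max_right _ _)
  have hμ0 : ℵ₀ ≤ μ := hL0.trans (le_max_left _ _)
  have hform : ∀ k : ℕ, #(L.Formula ((B ⊕ γ) ⊕ (Fin k × α))) ≤ μ := by
    intro k
    have hinj : Function.Injective (fun φ : L.Formula ((B ⊕ γ) ⊕ (Fin k × α)) =>
        (⟨0, φ⟩ : Σ n, L.BoundedFormula ((B ⊕ γ) ⊕ (Fin k × α)) n)) := fun φ ψ h => by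
      simpa using h
    refine (mk_le_of_injective hinj).trans (BoundedFormula.card_le.trans (max_le hμ0 ?_))
    refine add_le_of_le hμ0 ?_ ?_
    · simp only [mk_sum, lift_add, lift_lift]
      refine add_le_of_le hμ0 (add_le_of_le hμ0 ?_ ?_) ?_
      · exact (lift_id'.{max u v, w} #B).trans_le (le_max_right _ _)
      · refine le_trans (le_of_lt ?_) hμ0
        simp
      · refine le_trans (le_of_lt ?_) hμ0
        exact lift_lt_aleph0.2 (mk_lt_aleph0 (α := Fin k × α))
    · refine le_trans ?_ (le_max_left _ _)
      have := lift_le.{w}.2 (le_max_left L.card ℵ₀)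
      refine le_trans (le_of_eq ?_) this
      exact congrFun lift_umax.{max u v, w} L.card
  calc #(Σ k : ℕ, L.Formula ((B ⊕ γ) ⊕ (Fin k × α))) ≤ Cardinal.sum (fun _ : ℕ => μ) := by
        rw [mk_sigma]
        exact sum_le_sum _ _ hform
    _ = ℵ₀ * μ := by simp
    _ = μ := aleph0_mul_eq hμ0
    _ < c := max_lt hL hB

variable [L.Structure N]

/-- If `a` makes none of many mutually indiscernible sequences of tuples indiscernible, then in some
elementary extension there are an indiscernible sequence, of any order type, of realizations of the
type of `a`, and finitely many tuples, satisfying all that is common to the given sequences, over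
which no tail of the sequence is indiscernible. -/
theorem exists_indiscernible_of_mutually_indiscernible {B : Set N} {γ α : Type} [Finite γ]
    [Finite α] (a : γ → N) {ι : Type (max u v w)} {I : ι → Type*} [∀ i, LinearOrder (I i)]
    {s : ∀ i, I i → α → N} (hs : L.MutuallyIndiscernibleOver B s)
    (hns : ∀ i, ¬ L.IndiscernibleOver (B ∪ Set.range a) (s i))
    (hL : Cardinal.lift.{w} L.theoryCard < #ι) (hB : #B < #ι)
    (O : Type (max u v w)) [LinearOrder O] {Q : Set O}
    (hQ : ∀ t, ∃ t' ∈ Q, t < t') (hQ' : ∀ t, ∃ t' ∉ Q, t < t') :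
    ∃ (N' : Type (max u v w)) (_ : L.Structure N') (f : N ↪ₑ[L] N') (s' : O → γ → N') (k : ℕ)
      (b : Fin k → α → N'),
      L.IndiscernibleOver (f '' B) s' ∧
      (∀ θ : L.Formula (B ⊕ γ), θ.Realize (Sum.elim (fun c => (c : N)) a) →
        ∀ t, θ.Realize (Sum.elim (fun c : B => f c) (s' t))) ∧
      (∀ θ : L.Formula (B ⊕ α), (∀ i t, θ.Realize (Sum.elim (fun c => (c : N)) (s i t))) →
        ∀ q, θ.Realize (Sum.elim (fun c : B => f c) (b q))) ∧
      ∀ t₀ : O, ¬ L.IndiscernibleOver (f '' B ∪ ⋃ q, Set.range (b q))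
        (fun t : Set.Ioi t₀ => s' t) := by
  classical
  have hsep : ∀ i, ∃ (p : Σ k : ℕ, L.Formula ((B ⊕ γ) ⊕ (Fin k × α))) (y z : Fin p.1 ↪o I i),
      p.2.Realize (Sum.elim (Sum.elim (fun b => (b : N)) a) (fun q => s i (y q.1) q.2)) ∧
      ¬ p.2.Realize (Sum.elim (Sum.elim (fun b => (b : N)) a) (fun q => s i (z q.1) q.2)) := by
    intro i
    have := hns i
    rw [indiscernibleOver_iff_fam (e := Sum.elim (fun b : B => (b : N)) a) (by simp),
      IndiscernibleOverFam] at this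
    push Not at this
    obtain ⟨k, φ, y, z, h | h⟩ := this
    · exact ⟨⟨k, φ⟩, y, z, h⟩
    · exact ⟨⟨k, φ⟩, z, y, h.2, h.1⟩
  choose p y z hy hz using hsep
  have hinf : Infinite ι := by
    rw [infinite_iff]
    refine le_trans ?_ hL.le
    exact aleph0_le_lift.2 (le_max_right _ _)
  -- In an empty structure all valuations agree, so nothing could be separated.
  have hne : Nonempty N := by
    by_contra hc
    rw [not_nonempty_iff] at hc
    obtain ⟨i⟩ := hinf.nonempty
    apply hz i
    convert hy i using 1
  obtain ⟨⟨k, φ⟩, hfib⟩ := exists_infinite_fiber p (card_sigma_formula_lt hL hB)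
  -- Countably many sequences suffice from here on: one for each finite set of natural numbers.
  obtain ⟨g⟩ : Nonempty (Finset ℕ ↪ p ⁻¹' {⟨k, φ⟩}) := by
    rw [← lift_mk_le']
    simp
  have hsep : ∀ W, ∃ y z : Fin k ↪o I (g W),
      φ.Realize (Sum.elim (Sum.elim (fun b => (b : N)) a) (fun q => s (g W) (y q.1) q.2)) ∧
      ¬ φ.Realize (Sum.elim (Sum.elim (fun b => (b : N)) a) (fun q => s (g W) (z q.1) q.2)) := by
    intro W
    have h1 := hy (g W)
    have h2 := hz (g W)
    have h3 : p (g W) = ⟨k, φ⟩ := (g W).2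
    revert h1 h2
    generalize y (g W) = y', z (g W) = z'
    revert y' z'
    rw [h3]
    exact fun y' z' h1 h2 => ⟨y', z', h1, h2⟩
  choose y' z' hy' hz' using hsep
  obtain ⟨N₁, _, f₁, x, hx, hxa⟩ := MutuallyIndiscernibleOver.exists_dual_sequence.{u, v, w} a
    (hs.comp (fun W => (g W : ι)) (Subtype.val_injective.comp g.injective) (fun _ => id))
    φ y' z' hy' hz'
  have : Nonempty N₁ := hne.map f₁
  obtain ⟨N₂, _, f₂, s', b, hind, hpat, hsa, hba⟩ := exists_indiscernible_with_pattern
    (fun b : B => f₁ b) x φ (fun W q => f₁ (s (g W) (y' W q.1) q.2)) hx O Q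
  refine ⟨N₂, inferInstance, f₂.comp f₁, s', k, fun q c => b (q, c), ?_, fun θ hθ t => ?_,
    fun θ hθ q => ?_, fun t₀ hc => ?_⟩
  · refine (indiscernibleOver_iff_fam ?_).2 hind
    ext
    simp
  · exact hsa θ (fun j => hxa j θ hθ) t
  · have := hba (θ.relabel (Sum.map id (fun c => (q, c)))) (fun W => by
      simp only [Formula.realize_relabel, Sum.elim_comp_map, Function.comp_id]
      have := (f₁.map_formula θ _).2 (hθ (g W) (y' W q))
      rw [Sum.comp_elim] at this
      exact this)
    simp only [Formula.realize_relabel, Sum.elim_comp_map, Function.comp_id] at this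
    exact this
  · rw [indiscernibleOver_iff_fam (e := Sum.elim (fun c : B => f₂ (f₁ c)) b)] at hc
    · obtain ⟨t, htQ, ht⟩ := hQ t₀
      obtain ⟨t', htQ', ht'⟩ := hQ' t₀
      -- Tuples of length one are enough: `φ(·, b)` holds at `t ∈ Q` and fails at `t' ∉ Q`.
      have := hc 1 (φ.relabel (Sum.elim (Sum.map Sum.inl (fun c => (0, c)))
        (fun q => Sum.inl (Sum.inr q))))
        (OrderEmbedding.ofStrictMono (fun _ => ⟨t, ht⟩) (Subsingleton.strictMono _))
        (OrderEmbedding.ofStrictMono (fun _ => ⟨t', ht'⟩) (Subsingleton.strictMono _))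
      simp only [Formula.realize_relabel] at this
      refine htQ' ((hpat t').1 ?_)
      convert this.1 ?_ using 1
      · ext ((c | c) | q) <;> rfl
      · convert (hpat t).2 htQ using 1
        ext ((c | c) | q) <;> rfl
    · ext
      simp

end Combination

-- Order types of regular cardinals

section RegularOrder

theorem exists_forall_lt_of_isRegular {c : Cardinal.{w}} (hc : c.IsRegular) {J : Type w}
    (hJ : #J < c) (g : J → c.ord.ToType) : ∃ t, ∀ j, g j < t := by
  by_contra! h
  have hcof : IsCofinal (Set.range g) := fun t => by
    obtain ⟨j, hj⟩ := h t
    exact ⟨g j, ⟨j, rfl⟩, hj⟩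
  have h1 := (Order.cof_le hcof).trans mk_range_le
  rw [Ordinal.cof_toType, hc.cof_ord] at h1
  exact h1.not_gt hJ

theorem noMaxOrder_ord_toType {c : Cardinal.{w}} (hc : c.IsRegular) :
    NoMaxOrder c.ord.ToType :=
  ⟨fun t => by
    obtain ⟨t', h⟩ := exists_forall_lt_of_isRegular hc (J := PUnit)
      (by simpa using one_lt_aleph0.trans_le hc.aleph0_le) (fun _ => t)
    exact ⟨t', h ⟨⟩⟩⟩

/-- The order type of a regular cardinal has an unbounded subset with unbounded complement. -/
theorem exists_unbounded_compl_unbounded {c : Cardinal.{w}} (hc : c.IsRegular) :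
    ∃ Q : Set c.ord.ToType, (∀ t, ∃ t' ∈ Q, t < t') ∧ ∀ t, ∃ t' ∉ Q, t < t' := by
  have := noMaxOrder_ord_toType hc
  have hO : #c.ord.ToType = c := by simp
  obtain ⟨e⟩ : Nonempty (c.ord.ToType × Bool ≃ c.ord.ToType) := by
    rw [← Cardinal.eq, mk_prod, hO]
    simpa using mul_eq_left hc.aleph0_le
      (ofNat_lt_aleph0.le.trans hc.aleph0_le) (by simp : (2 : Cardinal) ≠ 0)
  -- Each half of the order has `c` elements, whereas a proper initial segment has fewer.
  have key : ∀ (b : Bool) t, ∃ t', t < e (t', b) := by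
    intro b t
    by_contra! h
    obtain ⟨t₁, ht₁⟩ := exists_gt t
    have : #c.ord.ToType ≤ #(Set.Iio t₁) :=
      mk_le_of_injective (f := fun o => (⟨e (o, b), (h o).trans_lt ht₁⟩ : Set.Iio t₁))
        fun o o' ho => by
          simpa using congrArg Subtype.val ho
    rw [hO] at this
    exact this.not_gt (by simpa using mk_Iio_lt t₁)
  refine ⟨{t | (e.symm t).2 = true}, fun t => ?_, fun t => ?_⟩
  · obtain ⟨t', h⟩ := key true t
    exact ⟨_, by simp, h⟩
  · obtain ⟨t', h⟩ := key false t
    exact ⟨_, by simp, h⟩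

/-- In an order without maximum, any finite set is contained in the range of an increasing
`ω`-sequence. -/
theorem exists_nat_orderEmbedding_range_superset {O : Type*} [LinearOrder O] [NoMaxOrder O]
    (X : Finset O) : ∀ t : O, (∀ x ∈ X, t < x) →
      ∃ J : ℕ ↪o O, (∀ x ∈ X, ∃ n, J n = x) ∧ ∀ n, t < J n := by
  induction X using Finset.induction_on_min with
  | empty =>
    intro t _
    have : Nonempty (Set.Ioi t) := (exists_gt t).elim fun a ha => ⟨⟨a, ha⟩⟩
    obtain ⟨g, hg⟩ := Nat.exists_strictMono (Set.Ioi t)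
    exact ⟨OrderEmbedding.ofStrictMono (fun n => (g n : O)) hg, by simp, fun n => (g n).2⟩
  | insert a X ha ih =>
    intro t ht
    obtain ⟨J, hJ, hJa⟩ := ih a ha
    refine ⟨OrderEmbedding.ofStrictMono (fun n => Nat.casesOn n a J)
      (strictMono_nat_of_lt_succ fun n => ?_), fun x hx => ?_, fun n => ?_⟩
    · cases n with
      | zero => exact hJa 0
      | succ n => exact J.strictMono (Nat.lt_succ_self n)
    · rcases Finset.mem_insert.1 hx with rfl | hx
      · exact ⟨0, rfl⟩
      · obtain ⟨n, hn⟩ := hJ x hx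
        exact ⟨n + 1, hn⟩
    · have hta := ht a (Finset.mem_insert_self a X)
      cases n with
      | zero => exact hta
      | succ n => exact hta.trans (hJa n)

end RegularOrder

-- Cutting a long sequence into mutually indiscernible blocks

section Blocks

variable {L : Language.{u, v}} {N : Type*} [L.Structure N]

/-- A failure of indiscernibility is visible on a subsequence of order type `ω`. -/
theorem exists_nat_subsequence_not_indiscernible {C : Set N} {O : Type*} [LinearOrder O]
    [NoMaxOrder O] {α : Type*} {s : O → α → N} {t : O}
    (h : ¬ L.IndiscernibleOver C (fun x : Set.Ioi t => s x)) :
    ∃ J : ℕ ↪o O, (∀ n, t < J n) ∧ ¬ L.IndiscernibleOver C (fun n => s (J n)) := by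
  classical
  rw [IndiscernibleOver] at h
  push Not at h
  obtain ⟨k, φ, i, j, hij⟩ := h
  obtain ⟨J, hJ, hJt⟩ := exists_nat_orderEmbedding_range_superset
    (Finset.univ.image (fun l => (i l : O)) ∪ Finset.univ.image (fun l => (j l : O))) t (by
      intro x hx
      simp only [Finset.mem_union, Finset.mem_image, Finset.mem_univ, true_and] at hx
      rcases hx with ⟨l, rfl⟩ | ⟨l, rfl⟩
      · exact (i l).2
      · exact (j l).2)
  have lift : ∀ i : Fin k ↪o Set.Ioi t, (∀ l, ∃ n, J n = i l) →
      ∃ i' : Fin k ↪o ℕ, ∀ l, J (i' l) = i l := by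
    intro i hi
    choose i' hi' using hi
    refine ⟨OrderEmbedding.ofStrictMono i' fun a b hab => ?_, hi'⟩
    rw [← J.lt_iff_lt, hi', hi']
    exact i.strictMono hab
  obtain ⟨i', hi'⟩ := lift i fun l => hJ _ (by simp)
  obtain ⟨j', hj'⟩ := lift j fun l => hJ _ (by simp)
  refine ⟨J, hJt, fun hc => ?_⟩
  have := hc k φ i' j'
  simp only [hi', hj'] at this
  tauto

/-- If no tail of an indiscernible sequence of regular length `c` is indiscernible over finitely many
additional sets, then over some of these sets there are `c` mutually indiscernible blocks of order
type `ω`, none of which is indiscernible over one further set. -/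
theorem IndiscernibleOver.exists_blocks {c : Cardinal.{w}} (hc : c.IsRegular) (hc' : ℵ₀ < c)
    {B : Set N} {α κ : Type*} [Finite κ] {s : c.ord.ToType → α → N} (d : κ → Set N)
    (h : L.IndiscernibleOver B s)
    (hn : ∀ t : c.ord.ToType, ¬ L.IndiscernibleOver (B ∪ ⋃ q, d q) (fun x : Set.Ioi t => s x)) :
    ∃ (G : Finset κ) (q : κ) (J : c.ord.ToType → ℕ ↪o c.ord.ToType),
      L.MutuallyIndiscernibleOver (B ∪ ⋃ q ∈ G, d q) (fun l n => s (J l n)) ∧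
      ∀ l, ¬ L.IndiscernibleOver ((B ∪ ⋃ q ∈ G, d q) ∪ d q) (fun n => s (J l n)) := by
  classical
  have := noMaxOrder_ord_toType hc
  let Ev : Set N → Prop := fun C => ∃ t : c.ord.ToType,
    L.IndiscernibleOver C (fun x : Set.Ioi t => s x)
  have hO : Nonempty c.ord.ToType := by
    simpa using hc.ne_zero
  have hEv : Ev B := ⟨hO.some,
    h.comp (OrderEmbedding.subtype (fun x => x ∈ Set.Ioi hO.some)) id⟩
  -- Otherwise eventual indiscernibility would survive the addition of the finitely many sets `d q`
  -- one after another, against `hn`.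
  obtain ⟨G, q, ⟨t₀, ht₀⟩, hq⟩ : ∃ (G : Finset κ) (q : κ), Ev (B ∪ ⋃ q ∈ G, d q) ∧
      ¬ Ev ((B ∪ ⋃ q ∈ G, d q) ∪ d q) := by
    by_contra! hcon
    have all : ∀ G : Finset κ, Ev (B ∪ ⋃ q ∈ G, d q) := by
      intro G
      induction G using Finset.induction_on with
      | empty => simpa using hEv
      | insert q G _ ih =>
        have := hcon G q ih
        rwa [Finset.set_biUnion_insert, Set.union_comm (d q), ← Set.union_assoc]
    have := Fintype.ofFinite κ
    obtain ⟨t, ht⟩ := all Finset.univ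
    exact hn t (by simpa using ht)
  have hq' : ∀ t : c.ord.ToType, ¬ L.IndiscernibleOver ((B ∪ ⋃ q ∈ G, d q) ∪ d q)
      (fun x : Set.Ioi t => s x) := fun t ht => hq ⟨t, ht⟩
  choose pick hpick hpick' using fun t => exists_nat_subsequence_not_indiscernible (hq' t)
  choose ub hub using fun t => exists_forall_lt_of_isRegular hc (J := ULift.{w} ℕ)
    (by simpa using hc') (fun n => pick t n.down)
  have hb : ∀ (l : c.ord.ToType) (g : Set.Iio l → c.ord.ToType), ∃ t, t₀ ≤ t ∧ ∀ l', ub (g l') ≤ t := by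
    intro l g
    obtain ⟨t, ht⟩ := exists_forall_lt_of_isRegular hc (J := Set.Iio l)
      (by simpa using mk_Iio_lt l) (fun l' => ub (g l'))
    exact ⟨max t t₀, le_max_right _ _, fun l' => (ht l').le.trans (le_max_left _ _)⟩
  choose nxt hnxt₀ hnxt using hb
  -- Transfinite recursion puts block `l` above `t₀` and all earlier blocks. Regularity leaves room:
  -- blocks are countable and fewer than `c` of them come earlier.
  let H : c.ord.ToType → c.ord.ToType := (wellFounded_lt (α := c.ord.ToType)).fix fun l g => nxt l fun l' => g l' l'.2
  have hH : ∀ l, H l = nxt l fun l' => H l' := fun l =>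
    WellFounded.fix_eq (wellFounded_lt (α := c.ord.ToType)) (fun l g => nxt l fun l' => g l' l'.2) l
  have hHt : ∀ l n, t₀ < pick (H l) n := fun l n => by
    refine lt_of_le_of_lt ?_ (hpick (H l) n)
    rw [hH]
    exact hnxt₀ _ _
  have hHlt : ∀ l l', l < l' → ∀ n n', pick (H l) n < pick (H l') n' := by
    intro l l' hl n n'
    refine (hub (H l) ⟨n⟩).trans (lt_of_le_of_lt ?_ (hpick (H l') n'))
    rw [hH l']
    exact hnxt l' (fun l' => H l') ⟨l, hl⟩
  refine ⟨G, q, fun l => pick (H l), ?_, fun l => hpick' (H l)⟩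
  exact ht₀.mutually_of_blocks (ι := c.ord.ToType) (fun l => OrderEmbedding.ofStrictMono
    (fun n => (⟨pick (H l) n, hHt l n⟩ : Set.Ioi t₀)) (fun a b hab => (pick (H l)).strictMono hab))
    hHlt

end Blocks

/-- A failure of indiscernibility is visible on finitely many coordinates. -/
theorem exists_coordinates_not_indiscernible {L : Language.{u, v}} {N : Type*} [L.Structure N]
    {B : Set N} {I : Type*} [LinearOrder I] {α : Type*} {s : I → α → N}
    (h : ¬ L.IndiscernibleOver B s) :
    ∃ (m : ℕ) (g : Fin m → α), ¬ L.IndiscernibleOver B (fun t c => s t (g c)) := by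
  classical
  rw [IndiscernibleOver] at h
  push Not at h
  obtain ⟨k, φ, i, j, hij⟩ := h
  obtain ⟨F, hF⟩ := exists_finset_realize_congr (N := N) φ
  let G : Finset α := F.biUnion (fun x => Sum.elim (fun _ => ∅) (fun q => {q.2}) x)
  have hG : ∀ l c, Sum.inr (l, c) ∈ F → c ∈ G := fun l c hx =>
    Finset.mem_biUnion.2 ⟨_, hx, by simp⟩
  refine ⟨G.card, fun l => G.equivFin.symm l, fun hc => ?_⟩
  rcases G.eq_empty_or_nonempty with hGe | ⟨c₀, hc₀⟩
  · have := hF (Sum.elim (fun b => (b : N)) (fun q => s (i q.1) q.2))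
      (Sum.elim (fun b => (b : N)) (fun q => s (j q.1) q.2)) (by
        rintro (b | ⟨l, c⟩) hx
        · rfl
        · exact absurd (hG l c hx) (by simp [hGe]))
    tauto
  let r : α → Fin G.card := fun c =>
    if hc : c ∈ G then G.equivFin ⟨c, hc⟩ else G.equivFin ⟨c₀, hc₀⟩
  have key := hc k (φ.relabel (Sum.map id (Prod.map id r))) i j
  simp only [Formula.realize_relabel, Sum.elim_comp_map, Function.comp_id] at key
  have hr : ∀ i : Fin k ↪o I,
      φ.Realize (Sum.elim (fun b => (b : N)) (fun q => s (i q.1) q.2)) ↔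
      φ.Realize (Sum.elim (fun b => (b : N))
        ((fun q : Fin k × Fin G.card => s (i q.1) (G.equivFin.symm q.2)) ∘ Prod.map id r)) := by
    refine fun i => hF _ _ ?_
    rintro (b | ⟨l, c⟩) hx
    · rfl
    · simp [r, hG l c hx]
  have h1 := hr i
  have h2 := hr j
  tauto

theorem mk_image_union_lt {N N' : Type w} (f : N → N') {B : Set N} {D : Set N'}
    {c : Cardinal.{w}} (hc : ℵ₀ ≤ c) (hB : #B < c) (hD : D.Finite) :
    #(f '' B ∪ D : Set N') < c :=
  (mk_union_le _ _).trans_lt (add_lt_of_lt hc (mk_image_le.trans_lt hB) (hD.lt_aleph0.trans_le hc))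

end FirstOrder.Language

-- The two exchanges

open FirstOrder.Language in
theorem mainTheorem2 {L : FirstOrder.Language.{u, v}} {M : Type w} [L.Structure M]
    (A : Set M) (n : ℕ) (p : L.TypeOver A n) (hp : p.IsIndependent) :
    ∃ (N : Type (max u v w)) (_ : L.Structure N) (f : M ↪ₑ[L] N)
      (A' : Set N) (a : Fin n → N)
      (ι : Type (max u v w)) (s : ι → ℕ → N),
      f '' A ⊆ A' ∧ (A' \ f '' A).Finite ∧
      p.RealizedBy f a ∧
      #ι = Cardinal.lift.{w} (Order.succ L.theoryCard) +
        Cardinal.lift.{max u v} (Order.succ #A) ∧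
      L.MutuallyIndiscernibleOver A' (fun i k (_ : Unit) => s i k) ∧
      ∀ i, ¬ L.IndiscernibleOver (A' ∪ Set.range a) (fun k (_ : Unit) => s i k) := by
  classical
  have hL0 : ℵ₀ ≤ Cardinal.lift.{w} L.theoryCard := aleph0_le_lift.2 (le_max_right _ _)
  set μ : Cardinal.{max u v w} := max (Cardinal.lift.{w} L.theoryCard)
    (Cardinal.lift.{max u v} #A) with hμ
  have hμ0 : ℵ₀ ≤ μ := hL0.trans (le_max_left _ _)
  set c : Cardinal.{max u v w} := Order.succ μ with hcdef
  have hcμ : μ < c := Order.lt_succ μ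
  have hc : c.IsRegular := isRegular_succ hμ0
  have hc' : ℵ₀ < c := hμ0.trans_lt hcμ
  have hLc : Cardinal.lift.{w} L.theoryCard < c := (le_max_left _ _).trans_lt hcμ
  have hcard : c = Cardinal.lift.{w} (Order.succ L.theoryCard) +
      Cardinal.lift.{max u v} (Order.succ #A) := by
    rw [lift_succ, lift_succ, add_eq_max (hL0.trans (Order.le_succ _)), hcdef, hμ]
    exact (Order.succ_mono).map_max
  have hO : #c.ord.ToType = c := by simp
  obtain ⟨Q, hQ, hQ'⟩ := exists_unbounded_compl_unbounded hc
  have hp := hp c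
  simp only [TypeOver.DpRankLT] at hp
  push Not at hp
  obtain ⟨N₁, _, f₁, a, hpa, ι, hι, I, _, _, α, s, hs, hns⟩ := hp
  choose m g hg using fun i => exists_coordinates_not_indiscernible (hns i)
  -- There are only countably many lengths, fewer than the cofinality of `c`, so `c` of the
  -- sequences may be taken with tuples of the same finite length.
  obtain ⟨⟨m₀⟩, hm₀⟩ := infinite_pigeonhole_card (fun i => ULift.up.{max u v w} (m i)) c hι.ge
    hc.aleph0_le (by simpa [hc.cof_ord] using hc')
  let ι' := (fun i => ULift.up.{max u v w} (m i)) ⁻¹' {⟨m₀⟩}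
  have hg' : ∀ i : ι', ∃ g' : Fin m₀ → α i,
      ¬ L.IndiscernibleOver (f₁ '' A ∪ Set.range a) (fun t c => s i t (g' c)) := by
    rintro ⟨i, hi⟩
    have hi' : m i = m₀ := congrArg ULift.down hi
    subst hi'
    exact ⟨g i, hg i⟩
  choose g' hg' using hg'
  have hB₁ : #(f₁ '' A) < c := by
    refine lt_of_le_of_lt ?_ ((le_max_right _ _).trans_lt hcμ : Cardinal.lift.{max u v} #A < c)
    have := mk_image_le_lift (f := f₁) (s := A)
    rw [lift_id'.{w, max u v}] at this
    exact this.trans_eq (congrFun lift_umax.{w, max u v} #A)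
  have hs₁ := hs.comp (fun i : ι' => (i : ι)) Subtype.val_injective (β := fun _ => Fin m₀)
    (fun i => g' i)
  obtain ⟨N₂, _, f₂, s₂, k₂, b₂, hind₂, ha₂, -, hn₂⟩ :=
    exists_indiscernible_of_mutually_indiscernible.{u, v, w} a hs₁ hg' (hLc.trans_le hm₀)
      (hB₁.trans_le hm₀) c.ord.ToType hQ hQ'
  -- The coordinates of the tuples `b₂` are added separately, so that a single element does the
  -- separating.
  obtain ⟨G₂, q₂, J₂, hmut₂, hJ₂⟩ := hind₂.exists_blocks hc hc' (κ := Fin k₂ × Fin m₀)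
    (fun q => {b₂ q.1 q.2}) (by
      intro t ht
      refine hn₂ t (ht.mono (Set.union_subset_union_right _ (Set.iUnion_subset fun q => ?_)))
      rintro _ ⟨j, rfl⟩
      exact Set.mem_iUnion.2 ⟨(q, j), rfl⟩)
  set D₂ : Set N₂ := ⋃ q ∈ G₂, {b₂ q.1 q.2} with hD₂
  have hD₂f : D₂.Finite := G₂.finite_toSet.biUnion fun _ _ => Set.finite_singleton _
  have hB₂ : #(f₂ '' (f₁ '' A) ∪ D₂ : Set N₂) < c := mk_image_union_lt f₂ hc.aleph0_le hB₁ hD₂f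
  -- That element now plays the part of `a`, whence `s₃` is a sequence of single elements.
  obtain ⟨N₃, _, f₃, s₃, k₃, b₃, hind₃, -, hb₃, hn₃⟩ :=
    exists_indiscernible_of_mutually_indiscernible.{u, v, w} (fun _ : Unit => b₂ q₂.1 q₂.2) hmut₂
      (fun l => by rw [Set.range_const]; exact hJ₂ l) (by rwa [hO]) (by rwa [hO])
      c.ord.ToType hQ hQ'
  -- This time each tuple `b₃ q` is added as a whole, so that the final separating tuple is a
  -- realization of `p`.
  obtain ⟨G₃, q₃, J₃, hmut₃, hJ₃⟩ := hind₃.exists_blocks hc hc' (fun q => Set.range (b₃ q)) hn₃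
  have hpre : ∀ φ ∈ p, ∀ t,
      φ.Realize (Sum.elim (fun c : A => f₂ (f₁ c)) (s₂ t)) := by
    intro φ hφ t
    have := ha₂ (φ.relabel (Sum.map (fun c : A => ⟨f₁ c, Set.mem_image_of_mem _ c.2⟩) id)) (by
      simp only [Formula.realize_relabel, Sum.elim_comp_map, Function.comp_id]
      exact hpa φ hφ) t
    simp only [Formula.realize_relabel, Sum.elim_comp_map, Function.comp_id] at this
    exact this
  refine ⟨N₃, inferInstance, f₃.comp (f₂.comp f₁), _, b₃ q₃, c.ord.ToType,
    fun l k => s₃ (J₃ l k) (), ?_, ?_, fun φ hφ => ?_, hO.trans hcard, hmut₃, hJ₃⟩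
  · rintro _ ⟨x, hx, rfl⟩
    exact Or.inl ⟨f₂ (f₁ x), Or.inl ⟨f₁ x, ⟨x, hx, rfl⟩, rfl⟩, rfl⟩
  · refine ((hD₂f.image f₃).union
      (G₃.finite_toSet.biUnion fun q _ => Set.finite_range (b₃ q))).subset ?_
    rintro x ⟨⟨y, ⟨z, ⟨x', hx', rfl⟩, rfl⟩ | hy, rfl⟩ | hx, hx'⟩
    · exact absurd ⟨x', ‹_›, rfl⟩ hx'
    · exact Or.inl ⟨y, hy, rfl⟩
    · exact Or.inr hx
  · have := hb₃ (φ.relabel (Sum.map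
      (fun c : A => ⟨f₂ (f₁ c), Or.inl ⟨f₁ c, ⟨c, c.2, rfl⟩, rfl⟩⟩) id)) (fun l k => by
      simp only [Formula.realize_relabel, Sum.elim_comp_map, Function.comp_id]
      exact hpre φ hφ _) q₃
    simp only [Formula.realize_relabel, Sum.elim_comp_map, Function.comp_id] at this
    exact this
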